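/- Let $\|\cdot\|$ be an arbitrary norm on $\mathbb{R}^m$, let $\Xi\subseteq\mathbb{R}^m$, let $\widehat\xi_1,\dots,\widehat\xi_N\in\Xi$ ($N\ge 1$) be data points with empirical distribution $\widehat{\mathbb{P}}_N=\frac1N\sum_{i=1}^N\delta_{\widehat\xi_i}$, and let $\ell=\max_{k\le K}\ell_k$ with $K\ge 1$ and $\ell_k:\mathbb{R}^m\to\overline{\mathbb{R}}=[-\infty,\infty]$. Let $\mathcal{M}(\Xi)$ be the set of probability distributions $\mathbb{Q}$ supported on $\Xi$ with $\mathbb{E}^{\mathbb{Q}}[\|\xi\|]<\infty$, let $$d_{\mathrm W}(\mathbb{Q}_1,\mathbb{Q}_2)=\inf\Big\{\int\|\xi_1-\xi_2\|\,\Pi(\mathrm d\xi_1,\mathrm d\xi_2)\;:\;\Pi\text{ has marginals }\mathbb{Q}_1,\mathbb{Q}_2\Big\}$$ be the Wasserstein distance, and for $\varepsilon\ge 0$ let $\mathbb{B}_\varepsilon(\widehat{\mathbb{P}}_N)=\{\mathbb{Q}\in\mathcal{M}(\Xi): d_{\mathrm W}(\widehat{\mathbb{P}}_N,\mathbb{Q})\le\varepsilon\}$.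 Expectations of extended-real-valued functions are defined by $\mathbb{E}^{\mathbb{Q}}[\ell]=\mathbb{E}^{\mathbb{Q}}[\max\{\ell,0\}]+\mathbb{E}^{\mathbb{Q}}[\min\{\ell,0\}]$ with $\infty-\infty=\infty$. Assume that $\Xi$ is convex and closed, that each $-\ell_k$ is proper (that is, $-\ell_k>-\infty$ everywhere and $-\ell_k<\infty$ somewhere), convex and lower semicontinuous, and that no $\ell_k$ is identically $-\infty$ on $\Xi$. Then, for every $\varepsilon\ge0$, the worst-case expectation $\sup_{\mathbb{Q}\in\mathbb{B}_\varepsilon(\widehat{\mathbb{P}}_N)}\mathbb{E}^{\mathbb{Q}}[\ell(\xi)]$ equals the optimal value of the finite program $$\begin{array}{cll}\displaystyle\sup_{\alpha_{ik}\in\mathbb{R},\,q_{ik}\in\mathbb{R}^m}&\displaystyle\frac1N\sum_{i=1}^N\sum_{k=1}^K\alpha_{ik}\,\ell_k\Big(\widehat\xi_i-\frac{q_{ik}}{\alpha_{ik}}\Big)\\ \text{s.t.}&\displaystyle\frac1N\sum_{i=1}^N\sum_{k=1}^K\|q_{ik}\|\le\varepsilon,\\ &\displaystyle\sum_{k=1}^K\alpha_{ik}=1&\forall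 i\le N,\\ &\alpha_{ik}\ge0&\forall i\le N,\ k\le K,\\ &\displaystyle\widehat\xi_i-\frac{q_{ik}}{\alpha_{ik}}\in\Xi&\forall i\le N,\ k\le K,\end{array}$$ which is convex (its feasible set is convex and its objective is concave on it). Here, for $\alpha_{ik}=0$, the last constraint means $q_{ik}=0$, one sets $q_{ik}/\alpha_{ik}=0/0=0$, and the $ik$-th term of the objective is $0$. Moreover, let $(\alpha_{ik}(r),q_{ik}(r))_{r\in\mathbb{N}}$ be a sequence of feasible points whose objective values converge (in $\overline{\mathbb{R}}$) to the supremum of this program, and put $\xi_{ik}(r)=\widehat\xi_i-q_{ik}(r)/\alpha_{ik}(r)$. Then the discrete probability distributions $\mathbb{Q}_r=\frac1N\sum_{i=1}^N\sum_{k=1}^K\alpha_{ik}(r)\,\delta_{\xi_{ik}(r)}$ belong to $\mathbb{B}_\varepsilon(\widehat{\mathbb{P}}_N)$ for all $r$, and $$\sup_{\mathbb{Q}\in\mathbb{B}_\varepsilon(\widehat{\mathbb{P}}_N)}\mathbb{E}^{\mathbb{Q}}[\ell(\xi)]=\lim_{r\to\infty}\mathbb{E}^{\mathbb{Q}_r}[\ell(\xi)]=\lim_{r\to\infty}\frac1N\sum_{i=1}^N\sum_{k=1}^K\alpha_{ik}(r)\,\ell(\xi_{ik}(r)),$$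 where terms with $\alpha_{ik}(r)=0$ count as $0$. -/

import Mathlib

open MeasureTheory Filter Topology
open scoped ENNReal

namespace WassersteinDRO

noncomputable section

/-- An extended-real-valued function is proper if it never takes the value `-∞` and is smaller
than `+∞` somewhere. -/
def IsProper {V : Type*} (f : V → EReal) : Prop :=
  (∃ x, f x < ⊤) ∧ ∀ x, ⊥ < f x

/-- Convexity on `S` of an extended-real-valued function: `S` and the epigraph of `f` over `S`
are convex. -/
def IsConvexFunOn {V : Type*} [AddCommMonoid V] [Module ℝ V] (S : Set V) (f : V → EReal) : Prop :=
  Convex ℝ S ∧ Convex ℝ {p : V × ℝ | p.1 ∈ S ∧ f p.1 ≤ (p.2 : EReal)}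

/-- The expectation `𝔼[max{f, 0}] + 𝔼[min{f, 0}]` of an extended-real-valued function, with the
convention `∞ - ∞ = ∞`. -/
def expect {E : Type*} [MeasurableSpace E] (Q : Measure E) (f : E → EReal) : EReal :=
  if ∫⁻ x, (f x).toENNReal ∂Q = ⊤ then ⊤
  else ((∫⁻ x, (f x).toENNReal ∂Q : ℝ≥0∞) : EReal) - ((∫⁻ x, (-f x).toENNReal ∂Q : ℝ≥0∞) : EReal)

/-- The pointwise maximum `ℓ(ξ) = max_k ℓ_k(ξ)`. -/
def maxLoss {E : Type*} {K : ℕ} (ℓ : Fin K → E → EReal) (ξ : E) : EReal :=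
  ⨆ k, ℓ k ξ

section Normed

variable {E : Type*} [NormedAddCommGroup E] [NormedSpace ℝ E]

/-- The convexity assumption: `Ξ` is convex and closed, every `-ℓ_k` is proper, convex and lower
semicontinuous, and no `ℓ_k` is identically `-∞` on `Ξ`. -/
structure ConvexityAssumption {K : ℕ} (Ξ : Set E) (ℓ : Fin K → E → EReal) : Prop where
  convex : Convex ℝ Ξ
  isClosed : IsClosed Ξ
  proper : ∀ k, IsProper fun ξ => -ℓ k ξ
  convexFun : ∀ k, IsConvexFunOn Set.univ fun ξ => -ℓ k ξ
  lsc : ∀ k, LowerSemicontinuous fun ξ => -ℓ k ξ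
  not_bot : ∀ k, ∃ ξ ∈ Ξ, ℓ k ξ ≠ ⊥

section Measures

variable [MeasurableSpace E]

/-- The space `𝓜(Ξ)` of probability distributions on `Ξ` with finite first moment. -/
def distributions (Ξ : Set E) : Set (Measure E) :=
  {Q | IsProbabilityMeasure Q ∧ Q Ξᶜ = 0 ∧ ∫⁻ ξ, ‖ξ‖ₑ ∂Q < ⊤}

/-- The (1-)Wasserstein distance: infimum of the transportation costs over all joint
distributions with the given marginals. -/
def wasserstein (Q₁ Q₂ : Measure E) : ℝ≥0∞ :=
  ⨅ (P : Measure (E × E)) (_ : P.map Prod.fst = Q₁ ∧ P.map Prod.snd = Q₂),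
    ∫⁻ p, ‖p.1 - p.2‖ₑ ∂P

/-- The Wasserstein ball of radius `ε` around `P` in `𝓜(Ξ)`. -/
def wassersteinBall (Ξ : Set E) (P : Measure E) (ε : ℝ) : Set (Measure E) :=
  {Q | Q ∈ distributions Ξ ∧ wasserstein P Q ≤ ENNReal.ofReal ε}

/-- The empirical distribution of the sample `ξhat`. -/
def empirical {N : ℕ} (ξhat : Fin N → E) : Measure E :=
  (N : ℝ≥0∞)⁻¹ • ∑ i, Measure.dirac (ξhat i)

/-- The worst-case expectation of `f` over a set of distributions. -/
def worstCaseExpectation (B : Set (Measure E)) (f : E → EReal) : EReal :=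
  ⨆ Q ∈ B, expect Q f

end Measures

/-- Decision variables `(α, q)`. -/
abbrev Decision (E : Type*) (N K : ℕ) : Type _ :=
  (Fin N → Fin K → ℝ) × (Fin N → Fin K → E)

/-- The point `ξ_ik = ξhat_i - q_ik / α_ik`. With `0⁻¹ = 0` it equals `ξhat_i` for
`α_ik = 0` and `q_ik = 0`, in accordance with `0 / 0 = 0`. -/
def atom {N K : ℕ} (ξhat : Fin N → E) (d : Decision E N K) (i : Fin N) (k : Fin K) : E :=
  ξhat i - (d.1 i k)⁻¹ • d.2 i k

/-- The feasible set of the finite program. If `α_ik = 0` and `q_ik ≠ 0` then `q_ik / α_ik` is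
infinite, so that `ξhat_i - q_ik / α_ik ∉ Ξ`; hence the last constraint includes
`α_ik = 0 → q_ik = 0`. -/
def feasibleSet {N : ℕ} (K : ℕ) (Ξ : Set E) (ξhat : Fin N → E) (ε : ℝ) : Set (Decision E N K) :=
  {d | (N : ℝ)⁻¹ * ∑ i, ∑ k, ‖d.2 i k‖ ≤ ε ∧
    (∀ i, ∑ k, d.1 i k = 1) ∧
    (∀ i k, 0 ≤ d.1 i k) ∧
    ∀ i k, (d.1 i k = 0 → d.2 i k = 0) ∧ atom ξhat d i k ∈ Ξ}

/-- The objective `(1/N) ∑_i ∑_k α_ik ℓ_k(ξhat_i - q_ik / α_ik)`, with `0 · (-∞) = 0`. -/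
def objective {N K : ℕ} (ξhat : Fin N → E) (ℓ : Fin K → E → EReal) (d : Decision E N K) : EReal :=
  (((N : ℝ)⁻¹ : ℝ) : EReal) * ∑ i, ∑ k, (d.1 i k : EReal) * ℓ k (atom ξhat d i k)

/-- The optimal value of the finite program. -/
def programValue {N K : ℕ} (Ξ : Set E) (ξhat : Fin N → E) (ℓ : Fin K → E → EReal) (ε : ℝ) :
    EReal :=
  ⨆ d ∈ feasibleSet K Ξ ξhat ε, objective ξhat ℓ d

/-- The discrete distribution `(1/N) ∑_i ∑_k α_ik δ_{ξ_ik}` induced by `(α, q)`. -/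
def inducedDistribution [MeasurableSpace E] {N K : ℕ} (ξhat : Fin N → E) (d : Decision E N K) :
    Measure E :=
  (N : ℝ≥0∞)⁻¹ • ∑ i, ∑ k, ENNReal.ofReal (d.1 i k) • Measure.dirac (atom ξhat d i k)

end Normed

end

end WassersteinDRO

/-! Lower bound: a feasible `(α, q)` yields a transport plan that moves mass `α_ik / N` from
`ξhat_i` to `ξ_ik`. Its cost is the average of the `‖q_ik‖`, so the induced distribution lies in the
ball, and `ℓ ≥ ℓ_k` makes its expected loss at least the objective
(`inducedDistribution_mem_wassersteinBall`, `objective_le_expect_inducedDistribution`).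

Upper bound: concave upper semicontinuous losses grow at most linearly, so the positive part of `ℓ`
is integrable for every `Q` in the ball. If the negative part is not, the expectation is `-∞`.
Otherwise a coupling of cost below `ε + 1/(n+1)` splits `N • Q` into probabilities `μ_i`, one per
sample point, and the space is partitioned into sets `A_k` where `ℓ_k` is maximal. By Jensen, the
mass `μ_i (A_k)` together with the integral of `(x, ℓ x)` over `A_k` lies in the cone over the
hypograph of `ℓ_k`. These finitely many vectors stay bounded as `n → ∞`; a limit point is a feasible
point with budget exactly `ε`, so no optimal coupling is needed. The cone may fail to be closed at
mass `0`, but `μ_i ≤ N • Q` gives uniform integrability, which excludes an escape of moments there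
(`mem_perspective_of_tendsto`, `tendsto_integral_zero_of_le_smul`).

The same cones give convexity: in the variables `(α, α ξhat - q, v)` the program has convex
constraints and a linear objective. -/

namespace WassersteinDRO

/-! ### Perspective cones and convexity of the finite program. -/

/-- The part over `Ξ` of the hypograph of an extended-real-valued function. -/
def hypograph {E : Type*} (Ξ : Set E) (f : E → EReal) : Set (E × ℝ) :=
  {p | p.1 ∈ Ξ ∧ (p.2 : EReal) ≤ f p.1}

/-- The cone `{(a, a • x) | 0 ≤ a, x ∈ C}` over `C`. -/
def perspective {W : Type*} [AddCommGroup W] [Module ℝ W] (C : Set W) : Set (ℝ × W) :=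
  {p | 0 ≤ p.1 ∧ ∃ x ∈ C, p.2 = p.1 • x}

theorem convex_perspective {W : Type*} [AddCommGroup W] [Module ℝ W] {C : Set W}
    (hC : Convex ℝ C) : Convex ℝ (perspective C) := by
  rintro ⟨a, w⟩ ⟨ha, x, hx, hw⟩ ⟨b, z⟩ ⟨hb, y, hy, hz⟩ s t hs ht hst
  simp only at ha hb hw hz
  subst hw hz
  have hsa : 0 ≤ s * a := mul_nonneg hs ha
  have htb : 0 ≤ t * b := mul_nonneg ht hb
  refine ⟨by simpa using add_nonneg hsa htb, ?_⟩
  rcases (add_nonneg hsa htb).eq_or_lt with h0 | hpos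
  · have h1 : s * a = 0 := by linarith
    have h2 : t * b = 0 := by linarith
    exact ⟨x, hx, by simp [smul_smul, h1, h2]⟩
  -- The base points are averaged with weights proportional to their masses `s * a` and `t * b`.
  · refine ⟨(s * a / (s * a + t * b)) • x + (t * b / (s * a + t * b)) • y,
      hC hx hy (by positivity) (by positivity) (by field_simp), ?_⟩
    simp only [Prod.smul_mk, Prod.mk_add_mk, smul_eq_mul, smul_add, smul_smul]
    congr 2 <;> field_simp

section Normed

variable {E : Type*} [NormedAddCommGroup E] [NormedSpace ℝ E]

theorem convex_hypograph {Ξ : Set E} (hΞ : Convex ℝ Ξ) {f : E → EReal}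
    (hf : IsConvexFunOn Set.univ fun x => -f x) : Convex ℝ (hypograph Ξ f) := by
  rintro ⟨x, u⟩ ⟨hx, hu⟩ ⟨y, v⟩ ⟨hy, hv⟩ s t hs ht hst
  refine ⟨hΞ hx hy hs ht hst, ?_⟩
  have hx' : ((x, -u) : E × ℝ) ∈ {p : E × ℝ | p.1 ∈ Set.univ ∧ -f p.1 ≤ (p.2 : EReal)} :=
    ⟨trivial, by simpa using hu⟩
  have hy' : ((y, -v) : E × ℝ) ∈ {p : E × ℝ | p.1 ∈ Set.univ ∧ -f p.1 ≤ (p.2 : EReal)} :=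
    ⟨trivial, by simpa using hv⟩
  have h := (hf.2 hx' hy' hs ht hst).2
  have e : s • -u + t • -v = -(s • u + t • v) := by simp; ring
  simp only [Prod.smul_mk, Prod.mk_add_mk, e, EReal.coe_neg, EReal.neg_le_neg_iff] at h
  exact h

theorem isClosed_hypograph {E : Type*} [TopologicalSpace E] {Ξ : Set E} (hΞ : IsClosed Ξ) {f : E → EReal}
    (hf : LowerSemicontinuous fun x => -f x) : IsClosed (hypograph Ξ f) := by
  have h1 : IsClosed {p : E × ℝ | p.1 ∈ Ξ} := hΞ.preimage continuous_fst
  have h2 : IsClosed {p : E × ℝ | -f p.1 ≤ ((-p.2 : ℝ) : EReal)} :=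
    hf.isClosed_epigraph.preimage
      (continuous_fst.prodMk (continuous_coe_real_ereal.comp continuous_snd.neg) :
        Continuous fun p : E × ℝ => (p.1, ((-p.2 : ℝ) : EReal)))
  convert h1.inter h2 using 1
  ext p
  simp [hypograph]

theorem ConvexityAssumption.lt_top {K : ℕ} {Ξ : Set E} {ℓ : Fin K → E → EReal}
    (hℓ : ConvexityAssumption Ξ ℓ) (k : Fin K) (x : E) : ℓ k x < ⊤ := by
  have h := (hℓ.proper k).2 x
  rw [lt_top_iff_ne_top]
  intro hx
  simp [hx] at h

theorem ConvexityAssumption.hypograph_nonempty {K : ℕ} {Ξ : Set E} {ℓ : Fin K → E → EReal}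
    (hℓ : ConvexityAssumption Ξ ℓ) (k : Fin K) : (hypograph Ξ (ℓ k)).Nonempty := by
  obtain ⟨x, hx, hb⟩ := hℓ.not_bot k
  exact ⟨(x, (ℓ k x).toReal), hx, by
    rw [EReal.coe_toReal (hℓ.lt_top k x).ne hb]⟩

/-- Multiplying `ξhat - q / α ∈ Ξ` by `α` makes it a condition on a point affine in `(α, q)`, with
no division. For `α = 0` the atom is `ξhat i`, so its membership in `Ξ` is automatic and only `q =
0` remains. -/
theorem mem_feasibleSet_iff {N K : ℕ} {Ξ : Set E} {ξhat : Fin N → E} (hξ : ∀ i, ξhat i ∈ Ξ)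
    {ε : ℝ} {d : Decision E N K} :
    d ∈ feasibleSet K Ξ ξhat ε ↔ (N : ℝ)⁻¹ * ∑ i, ∑ k, ‖d.2 i k‖ ≤ ε ∧
      (∀ i, ∑ k, d.1 i k = 1) ∧
      ∀ i k, (d.1 i k, d.1 i k • ξhat i - d.2 i k) ∈ perspective Ξ := by
  simp only [feasibleSet, Set.mem_ofPred_eq, perspective, atom]
  refine and_congr_right fun _ => and_congr_right fun _ => ?_
  rw [← forall_and]
  refine forall_congr' fun i => ?_
  rw [← forall_and]
  refine forall_congr' fun k => and_congr_right fun _ => ?_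
  rcases eq_or_ne (d.1 i k) 0 with h0 | h0
  · simp only [h0, zero_smul, inv_zero, zero_sub, sub_zero, forall_const, neg_eq_zero, hξ i,
      and_true]
    exact ⟨fun h => ⟨_, hξ i, h⟩, fun ⟨_, _, h⟩ => h⟩
  · constructor
    · rintro ⟨-, h⟩
      exact ⟨_, h, by rw [smul_sub, smul_inv_smul₀ h0]⟩
    · rintro ⟨x, hx, h⟩
      refine ⟨fun h' => absurd h' h0, ?_⟩
      have : ξhat i - (d.1 i k)⁻¹ • d.2 i k = x := by
        rw [← inv_smul_smul₀ h0 x, ← h, smul_sub, inv_smul_smul₀ h0]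
      rwa [this]

theorem convex_feasibleSet {N K : ℕ} {Ξ : Set E} (hΞ : Convex ℝ Ξ) {ξhat : Fin N → E}
    (hξ : ∀ i, ξhat i ∈ Ξ) (ε : ℝ) : Convex ℝ (feasibleSet K Ξ ξhat ε) := by
  intro d hd e he s t hs ht hst
  rw [mem_feasibleSet_iff hξ] at hd he ⊢
  obtain ⟨hd1, hd2, hd3⟩ := hd
  obtain ⟨he1, he2, he3⟩ := he
  refine ⟨?_, fun i => ?_, fun i k => ?_⟩
  · calc (N : ℝ)⁻¹ * ∑ i, ∑ k, ‖(s • d + t • e).2 i k‖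
        ≤ (N : ℝ)⁻¹ * ∑ i, ∑ k, (s * ‖d.2 i k‖ + t * ‖e.2 i k‖) := by
          gcongr with i _ k _
          refine (norm_add_le _ _).trans_eq ?_
          simp [norm_smul, abs_of_nonneg hs, abs_of_nonneg ht]
      _ = s * ((N : ℝ)⁻¹ * ∑ i, ∑ k, ‖d.2 i k‖) + t * ((N : ℝ)⁻¹ * ∑ i, ∑ k, ‖e.2 i k‖) := by
          simp only [Finset.sum_add_distrib, ← Finset.mul_sum]; ring
      _ ≤ s * ε + t * ε := by gcongr
      _ = ε := by rw [← add_mul, hst, one_mul]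
  · simp [Finset.sum_add_distrib, ← Finset.mul_sum, hd2 i, he2 i, hst]
  · convert convex_perspective hΞ (hd3 i k) (he3 i k) hs ht hst using 1
    ext
    · simp
    · simp only [Prod.fst_add, Prod.snd_add, Prod.smul_fst, Prod.smul_snd, Pi.add_apply,
        Pi.smul_apply, smul_eq_mul]
      module

theorem coe_sum_ereal {ι : Type*} (s : Finset ι) (f : ι → ℝ) :
    ((∑ i ∈ s, f i : ℝ) : EReal) = ∑ i ∈ s, (f i : EReal) := by
  classical
  induction s using Finset.induction_on with
  | empty => simp
  | insert a s ha ih => rw [Finset.sum_insert ha, Finset.sum_insert ha, EReal.coe_add, ih]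

theorem ne_bot_of_coe_le_mul_sum {ι : Type*} [Fintype ι] {c : ℝ} (hc : 0 < c) {f : ι → EReal}
    {s : ℝ} (h : (s : EReal) ≤ (c : EReal) * ∑ i, f i) (i : ι) : f i ≠ ⊥ := by
  classical
  intro hi
  have : ∑ i, f i = ⊥ := by
    rw [← Finset.add_sum_erase _ _ (Finset.mem_univ i), hi, EReal.bot_add]
  rw [this, EReal.coe_mul_bot_of_pos hc] at h
  exact absurd h (by simp)

theorem le_mul_of_mem_perspective_hypograph {Ξ : Set E} {f : E → EReal} {a v : ℝ} {x q : E}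
    (h : (a, (a • x - q, v)) ∈ perspective (hypograph Ξ f)) :
    (v : EReal) ≤ (a : EReal) * f (x - a⁻¹ • q) := by
  obtain ⟨ha, ⟨y, t⟩, ⟨-, ht⟩, h⟩ := h
  simp only [Prod.smul_mk, Prod.mk.injEq, smul_eq_mul] at h ha ht
  obtain ⟨hy, rfl⟩ := h
  rcases eq_or_ne a 0 with rfl | h0
  · simp
  · have : x - a⁻¹ • q = y := by
      rw [← inv_smul_smul₀ h0 y, ← hy, smul_sub, inv_smul_smul₀ h0]
    rw [this, EReal.coe_mul]
    exact mul_le_mul_of_nonneg_left ht (by exact_mod_cast ha)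

/-- The product, not `f` itself, is required to differ from `⊥`: with `a = 0` the loss may be `-∞`
at the atom. The apex of the cone then needs some base point, whence `hne`. -/
theorem mem_perspective_hypograph {Ξ : Set E} {f : E → EReal}
    (hne : (hypograph Ξ f).Nonempty) {a : ℝ} {x q : E} (ha : 0 ≤ a) (hq : a = 0 → q = 0)
    (hx : x - a⁻¹ • q ∈ Ξ) (ht : f (x - a⁻¹ • q) ≠ ⊤)
    (hb : (a : EReal) * f (x - a⁻¹ • q) ≠ ⊥) :
    (a, (a • x - q, ((a : EReal) * f (x - a⁻¹ • q)).toReal)) ∈ perspective (hypograph Ξ f) := by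
  refine ⟨ha, ?_⟩
  rcases eq_or_ne a 0 with rfl | h0
  · obtain ⟨y, hy⟩ := hne
    exact ⟨y, hy, by simp [hq rfl]⟩
  · have hb' : f (x - a⁻¹ • q) ≠ ⊥ := fun h => hb <| by
      rw [h, EReal.coe_mul_bot_of_pos (ha.lt_of_ne' h0)]
    refine ⟨(x - a⁻¹ • q, (f (x - a⁻¹ • q)).toReal), ⟨hx, (EReal.coe_toReal ht hb').le⟩, ?_⟩
    simp [EReal.toReal_mul, smul_sub, smul_inv_smul₀ h0]

theorem sum_sum_eq_sum_prod {M : Type*} [AddCommMonoid M] {N K : ℕ} (f : Fin N → Fin K → M) :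
    ∑ i, ∑ k, f i k = ∑ p : Fin N × Fin K, f p.1 p.2 :=
  (Fintype.sum_prod_type' f).symm

/-- Feasible points whose objective dominates a given real number, described by means of the
perspectives of the hypographs of the losses. -/
theorem feasible_and_le_objective_iff {N K : ℕ} (hN : 0 < N) {Ξ : Set E} {ξhat : Fin N → E}
    (hξ : ∀ i, ξhat i ∈ Ξ) {ℓ : Fin K → E → EReal} (hℓ : ConvexityAssumption Ξ ℓ)
    {ε s : ℝ} {d : Decision E N K} :
    (d ∈ feasibleSet K Ξ ξhat ε ∧ (s : EReal) ≤ objective ξhat ℓ d) ↔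
      (N : ℝ)⁻¹ * ∑ i, ∑ k, ‖d.2 i k‖ ≤ ε ∧ (∀ i, ∑ k, d.1 i k = 1) ∧
      ∃ v : Fin N → Fin K → ℝ, s ≤ (N : ℝ)⁻¹ * ∑ i, ∑ k, v i k ∧
        ∀ i k, (d.1 i k, (d.1 i k • ξhat i - d.2 i k, v i k)) ∈
          perspective (hypograph Ξ (ℓ k)) := by
  have hN' : (0 : ℝ) < (N : ℝ)⁻¹ := by positivity
  constructor
  · rintro ⟨⟨h1, h2, h3, h4⟩, hs⟩
    refine ⟨h1, h2, ?_⟩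
    -- A real lower bound on the sum excludes every `-∞` term, since `⊥` absorbs under addition.
    have hb : ∀ i k, (d.1 i k : EReal) * ℓ k (atom ξhat d i k) ≠ ⊥ := by
      unfold objective at hs
      rw [sum_sum_eq_sum_prod] at hs
      exact fun i k => ne_bot_of_coe_le_mul_sum hN' hs (i, k)
    have ht : ∀ i k, (d.1 i k : EReal) * ℓ k (atom ξhat d i k) ≠ ⊤ := by
      intro i k h
      have hlt := hℓ.lt_top k (atom ξhat d i k)
      rcases EReal.mul_eq_top _ _ |>.1 h with h | h | h | h
      · simp at h
      · have : d.1 i k < 0 := by exact_mod_cast h.1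
        exact absurd (h3 i k) this.not_ge
      · simp at h
      · exact hlt.ne h.2
    refine ⟨fun i k => ((d.1 i k : EReal) * ℓ k (atom ξhat d i k)).toReal, ?_, fun i k =>
      mem_perspective_hypograph (hℓ.hypograph_nonempty k) (h3 i k) (h4 i k).1 (h4 i k).2
        (hℓ.lt_top k _).ne (hb i k)⟩
    have e : objective ξhat ℓ d = (((N : ℝ)⁻¹ * ∑ i, ∑ k,
        ((d.1 i k : EReal) * ℓ k (atom ξhat d i k)).toReal : ℝ) : EReal) := by
      simp only [objective, EReal.coe_mul, coe_sum_ereal]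
      simp only [EReal.coe_toReal (ht _ _) (hb _ _)]
    rw [e] at hs
    exact_mod_cast hs
  · rintro ⟨h1, h2, v, hs, hv⟩
    refine ⟨(mem_feasibleSet_iff hξ).2 ⟨h1, h2, fun i k => ?_⟩, ?_⟩
    · obtain ⟨ha, y, hy, h⟩ := hv i k
      exact ⟨ha, y.1, hy.1, congrArg Prod.fst h⟩
    · calc (s : EReal) ≤ (((N : ℝ)⁻¹ * ∑ i, ∑ k, v i k : ℝ) : EReal) := by exact_mod_cast hs
        _ = (((N : ℝ)⁻¹ : ℝ) : EReal) * ∑ i, ∑ k, (v i k : EReal) := by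
          simp only [EReal.coe_mul, coe_sum_ereal]
        _ ≤ objective ξhat ℓ d := by
          refine mul_le_mul_of_nonneg_left ?_ (by exact_mod_cast hN'.le)
          exact Finset.sum_le_sum fun i _ => Finset.sum_le_sum fun k _ =>
            le_mul_of_mem_perspective_hypograph (hv i k)

/-- The hypograph of the objective is the projection along `v` of a set cut out by convex
constraints; convex combinations are taken of the witnesses `v` and `v'`. -/
theorem isConvexFunOn_neg_objective {N K : ℕ} (hN : 0 < N) {Ξ : Set E} {ξhat : Fin N → E}
    (hξ : ∀ i, ξhat i ∈ Ξ) {ℓ : Fin K → E → EReal} (hℓ : ConvexityAssumption Ξ ℓ) (ε : ℝ) :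
    IsConvexFunOn (feasibleSet K Ξ ξhat ε) fun d => -objective ξhat ℓ d := by
  have hset := convex_feasibleSet (K := K) hℓ.convex hξ ε
  refine ⟨hset, ?_⟩
  rintro ⟨d, u⟩ ⟨hd, hu⟩ ⟨e, w⟩ ⟨he, hw⟩ s t hs ht hst
  refine ⟨hset hd he hs ht hst, ?_⟩
  simp only at hd hu he hw
  rw [EReal.neg_le, ← EReal.coe_neg] at hu hw
  obtain ⟨-, -, v, hv, hvd⟩ := (feasible_and_le_objective_iff hN hξ hℓ).1 ⟨hd, hu⟩
  obtain ⟨-, -, v', hv', hve⟩ := (feasible_and_le_objective_iff hN hξ hℓ).1 ⟨he, hw⟩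
  have hf := (mem_feasibleSet_iff hξ).1 (hset hd he hs ht hst)
  rw [EReal.neg_le, ← EReal.coe_neg]
  refine ((feasible_and_le_objective_iff hN hξ hℓ).2 ⟨hf.1, hf.2.1,
    fun i k => s * v i k + t * v' i k, ?_, fun i k => ?_⟩).2
  · simp only [Finset.sum_add_distrib, ← Finset.mul_sum, Prod.snd_add, Prod.smul_snd, smul_eq_mul]
    have h1 := mul_le_mul_of_nonneg_left hv hs
    have h2 := mul_le_mul_of_nonneg_left hv' ht
    linarith
  · convert convex_perspective (convex_hypograph hℓ.convex (hℓ.convexFun k)) (hvd i k) (hve i k)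
      hs ht hst using 1
    ext
    · simp
    · simp only [Prod.fst_add, Prod.snd_add, Prod.smul_fst, Prod.smul_snd, Pi.add_apply,
        Pi.smul_apply, smul_eq_mul]
      module
    · simp

end Normed

/-! ### Expectations under finitely supported measures. -/

section Discrete

/-- Infinite values are harmless: `x - ⊤ = ⊥` in `EReal`, and one such term makes both sides `⊥`. -/
theorem coe_ennreal_sum_sub_sum {ι : Type*} (s : Finset ι) (p m : ι → ℝ≥0∞) :
    (((∑ j ∈ s, p j : ℝ≥0∞) : EReal) - ((∑ j ∈ s, m j : ℝ≥0∞) : EReal)) =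
      ∑ j ∈ s, ((p j : EReal) - (m j : EReal)) := by
  classical
  induction s using Finset.induction_on with
  | empty => simp
  | insert a s ha ih =>
    rw [Finset.sum_insert ha, Finset.sum_insert ha, Finset.sum_insert ha, ← ih,
      EReal.coe_ennreal_add, EReal.coe_ennreal_add]
    exact EReal.add_sub_add_comm (Or.inl (EReal.coe_ennreal_ne_bot _))
      (Or.inr (EReal.coe_ennreal_ne_bot _))

theorem coe_ennreal_mul_toENNReal_sub {a : ℝ} (ha : 0 ≤ a) {x : EReal} (hx : x ≠ ⊤) :
    ((ENNReal.ofReal a * x.toENNReal : ℝ≥0∞) : EReal) -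
      ((ENNReal.ofReal a * (-x).toENNReal : ℝ≥0∞) : EReal) = (a : EReal) * x := by
  induction x with
  | top => exact absurd rfl hx
  | bot =>
    rcases ha.eq_or_lt with rfl | ha
    · simp
    · simp [EReal.coe_mul_bot_of_pos ha, ENNReal.mul_top, ha]
  | coe r =>
    rw [← EReal.coe_neg, EReal.coe_ennreal_mul, EReal.coe_ennreal_mul]
    simp only [EReal.toENNReal_of_ne_top (EReal.coe_ne_top _), EReal.toReal_coe,
      EReal.coe_ennreal_ofReal, max_eq_left ha]
    norm_cast
    rw [← mul_sub]
    congr 1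
    rcases le_total r 0 with h | h <;> simp [h]

theorem coe_mul_sum_ereal {ι : Type*} (s : Finset ι) (f : ι → EReal) {c : ℝ} (hc : 0 ≤ c) :
    (c : EReal) * ∑ j ∈ s, f j = ∑ j ∈ s, (c : EReal) * f j := by
  classical
  induction s using Finset.induction_on with
  | empty => simp
  | insert a s ha ih =>
    rw [Finset.sum_insert ha, Finset.sum_insert ha, ← ih,
      EReal.left_distrib_of_nonneg_of_ne_top (by exact_mod_cast hc) (EReal.coe_ne_top _)]

theorem expect_sum_dirac {E : Type*} [MeasurableSpace E] [MeasurableSingletonClass E] {ι : Type*}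
    [Fintype ι] (x : ι → E) {a : ι → ℝ} (ha : ∀ j, 0 ≤ a j) {f : E → EReal}
    (hf : ∀ y, f y ≠ ⊤) :
    expect (∑ j, ENNReal.ofReal (a j) • Measure.dirac (x j)) f =
      ∑ j, (a j : EReal) * f (x j) := by
  have hint : ∀ g : E → ℝ≥0∞, ∫⁻ y, g y ∂(∑ j, ENNReal.ofReal (a j) • Measure.dirac (x j)) =
      ∑ j, ENNReal.ofReal (a j) * g (x j) := by
    intro g
    simp [lintegral_finsetSum_measure, lintegral_smul_measure]
  have hne : ∑ j, ENNReal.ofReal (a j) * (f (x j)).toENNReal ≠ ⊤ := by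
    refine ENNReal.sum_ne_top.2 fun j _ => ENNReal.mul_ne_top ENNReal.ofReal_ne_top ?_
    simpa using hf (x j)
  rw [expect, hint, hint, if_neg hne, coe_ennreal_sum_sub_sum]
  exact Finset.sum_congr rfl fun j _ => coe_ennreal_mul_toENNReal_sub (ha j) (hf _)

theorem le_maxLoss {E : Type*} {K : ℕ} (ℓ : Fin K → E → EReal) (k : Fin K) (x : E) :
    ℓ k x ≤ maxLoss ℓ x :=
  le_iSup (fun k => ℓ k x) k

end Discrete

/-! ### From feasible points to distributions in the ball. -/

section Normed

variable {E : Type*} [NormedAddCommGroup E] [NormedSpace ℝ E]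

theorem maxLoss_ne_top {K : ℕ} {Ξ : Set E} {ℓ : Fin K → E → EReal}
    (hℓ : ConvexityAssumption Ξ ℓ) (x : E) : maxLoss ℓ x ≠ ⊤ := by
  rw [maxLoss]
  rcases isEmpty_or_nonempty (Fin K) with h | h
  · simp
  · obtain ⟨k, hk⟩ := exists_eq_ciSup_of_finite (f := fun k => ℓ k x)
    rw [← hk]
    exact (hℓ.lt_top k x).ne

variable [MeasurableSpace E]

theorem inv_natCast_eq_ofReal {N : ℕ} (hN : 0 < N) :
    (N : ℝ≥0∞)⁻¹ = ENNReal.ofReal (N : ℝ)⁻¹ := by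
  rw [ENNReal.ofReal_inv_of_pos (by positivity), ENNReal.ofReal_natCast]

theorem inducedDistribution_eq_sum {N K : ℕ} (hN : 0 < N) (ξhat : Fin N → E)
    (d : Decision E N K) :
    inducedDistribution ξhat d = ∑ p : Fin N × Fin K,
      ENNReal.ofReal ((N : ℝ)⁻¹ * d.1 p.1 p.2) • Measure.dirac (atom ξhat d p.1 p.2) := by
  rw [inducedDistribution, sum_sum_eq_sum_prod, Finset.smul_sum, inv_natCast_eq_ofReal hN]
  refine Finset.sum_congr rfl fun p _ => ?_
  rw [smul_smul, ← ENNReal.ofReal_mul (by positivity)]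

theorem expect_inducedDistribution [MeasurableSingletonClass E] {N K : ℕ} (hN : 0 < N)
    (ξhat : Fin N → E) {d : Decision E N K} (hd : ∀ i k, 0 ≤ d.1 i k) {f : E → EReal}
    (hf : ∀ y, f y ≠ ⊤) :
    expect (inducedDistribution ξhat d) f =
      (((N : ℝ)⁻¹ : ℝ) : EReal) * ∑ i, ∑ k, (d.1 i k : EReal) * f (atom ξhat d i k) := by
  rw [inducedDistribution_eq_sum hN, expect_sum_dirac _ _ hf, sum_sum_eq_sum_prod,
    coe_mul_sum_ereal _ _ (by positivity)]
  · simp only [EReal.coe_mul, mul_assoc]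
  · exact fun p => mul_nonneg (by positivity) (hd _ _)

theorem objective_le_expect_inducedDistribution [MeasurableSingletonClass E] {N K : ℕ}
    (hN : 0 < N) {Ξ : Set E} (ξhat : Fin N → E) {d : Decision E N K} (hd : ∀ i k, 0 ≤ d.1 i k)
    {ℓ : Fin K → E → EReal} (hℓ : ConvexityAssumption Ξ ℓ) :
    objective ξhat ℓ d ≤ expect (inducedDistribution ξhat d) (maxLoss ℓ) := by
  rw [expect_inducedDistribution hN ξhat hd (maxLoss_ne_top hℓ), objective]
  refine mul_le_mul_of_nonneg_left ?_ (by exact_mod_cast (by positivity : (0 : ℝ) ≤ (N : ℝ)⁻¹))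
  refine Finset.sum_le_sum fun i _ => Finset.sum_le_sum fun k _ => ?_
  exact mul_le_mul_of_nonneg_left (le_maxLoss ℓ k _)
    (by exact_mod_cast hd i k)

theorem sum_weights_eq_one {N K : ℕ} (hN : 0 < N) {a : Fin N → Fin K → ℝ}
    (ha : ∀ i k, 0 ≤ a i k) (hs : ∀ i, ∑ k, a i k = 1) :
    ∑ p : Fin N × Fin K, ENNReal.ofReal ((N : ℝ)⁻¹ * a p.1 p.2) = 1 := by
  rw [← ENNReal.ofReal_sum_of_nonneg fun p _ => mul_nonneg (by positivity) (ha _ _),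
    ← Finset.mul_sum, ← sum_sum_eq_sum_prod]
  have : (N : ℝ) ≠ 0 := by positivity
  simp [hs, this]

theorem wasserstein_le {E : Type*} [NormedAddCommGroup E] [MeasurableSpace E]
    {Q₁ Q₂ : Measure E} {P : Measure (E × E)} (h₁ : P.map Prod.fst = Q₁)
    (h₂ : P.map Prod.snd = Q₂) : wasserstein Q₁ Q₂ ≤ ∫⁻ p, ‖p.1 - p.2‖ₑ ∂P :=
  iInf₂_le (f := fun (P : Measure (E × E)) (_ : P.map Prod.fst = Q₁ ∧ P.map Prod.snd = Q₂) =>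
    ∫⁻ p, ‖p.1 - p.2‖ₑ ∂P) P ⟨h₁, h₂⟩

theorem inducedDistribution_mem_wassersteinBall [BorelSpace E] [SecondCountableTopology E]
    {N K : ℕ} (hN : 0 < N) {Ξ : Set E} {ξhat : Fin N → E}
    {ε : ℝ} {d : Decision E N K} (hd : d ∈ feasibleSet K Ξ ξhat ε) :
    inducedDistribution ξhat d ∈ wassersteinBall Ξ (empirical ξhat) ε := by
  obtain ⟨h1, h2, h3, h4⟩ := hd
  have hw := sum_weights_eq_one hN h3 h2
  have hnn : ∀ p : Fin N × Fin K, 0 ≤ (N : ℝ)⁻¹ * d.1 p.1 p.2 :=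
    fun p => mul_nonneg (by positivity) (h3 _ _)
  rw [inducedDistribution_eq_sum hN]
  refine ⟨⟨⟨?_⟩, ?_, ?_⟩, ?_⟩
  · simpa using hw
  · simp [(h4 _ _).2]
  · simp only [lintegral_finsetSum_measure, lintegral_smul_measure, lintegral_dirac, smul_eq_mul]
    exact ENNReal.sum_lt_top.2 fun p _ => ENNReal.mul_lt_top ENNReal.ofReal_lt_top (by simp)
  -- The coupling moves mass `α_ik / N` from `ξhat_i` to the atom `ξ_ik`.
  · refine (wasserstein_le (P := ∑ p : Fin N × Fin K, ENNReal.ofReal ((N : ℝ)⁻¹ * d.1 p.1 p.2) •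
      Measure.dirac (ξhat p.1, atom ξhat d p.1 p.2)) ?_ ?_).trans ?_
    · ext s hs
      rw [Measure.map_apply measurable_fst hs, empirical, inv_natCast_eq_ofReal hN]
      simp only [Measure.finsetSum_apply, Measure.smul_apply, smul_eq_mul,
        Measure.dirac_apply' _ hs, Measure.dirac_apply' _ (measurable_fst hs)]
      rw [Fintype.sum_prod_type, Finset.mul_sum]
      refine Finset.sum_congr rfl fun i _ => ?_
      have : ∀ k, (Prod.fst ⁻¹' s).indicator (1 : E × E → ℝ≥0∞) (ξhat i, atom ξhat d i k) =
          s.indicator 1 (ξhat i) := fun k => rfl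
      simp only [this]
      rw [← Finset.sum_mul, ← ENNReal.ofReal_sum_of_nonneg fun k _ => hnn (i, k),
        ← Finset.mul_sum, h2, mul_one]
    · ext s hs
      rw [Measure.map_apply measurable_snd hs]
      simp only [Measure.finsetSum_apply, Measure.smul_apply, smul_eq_mul,
        Measure.dirac_apply' _ hs, Measure.dirac_apply' _ (measurable_snd hs)]
      rfl
    · simp only [lintegral_finsetSum_measure, lintegral_smul_measure, lintegral_dirac,
        smul_eq_mul]
      refine le_trans (le_of_eq ?_) (ENNReal.ofReal_le_ofReal h1)
      rw [sum_sum_eq_sum_prod, Finset.mul_sum,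
        ENNReal.ofReal_sum_of_nonneg fun p _ => by positivity]
      refine Finset.sum_congr rfl fun p _ => ?_
      rw [← ofReal_norm, ← ENNReal.ofReal_mul (hnn p), mul_assoc]
      congr 2
      -- Each leg costs `α * ‖q / α‖ = ‖q‖`; for `α = 0` this relies on `q = 0`.
      rcases eq_or_ne (d.1 p.1 p.2) 0 with h0 | h0
      · simp [h0, (h4 _ _).1 h0]
      · rw [atom, sub_sub_cancel, norm_smul, norm_inv, Real.norm_of_nonneg (h3 _ _),
          mul_inv_cancel_left₀ h0]

end Normed

/-! ### Linear growth and integrability of the positive part. -/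

section Majorant

variable {E : Type*} [NormedAddCommGroup E] [NormedSpace ℝ E]

/-- A concave upper semicontinuous function that is finite somewhere grows at most linearly. -/
theorem exists_le_add_mul_norm {f : E → EReal} (htop : ∀ x, f x ≠ ⊤)
    (hconv : IsConvexFunOn Set.univ fun x => -f x) (hlsc : LowerSemicontinuous fun x => -f x)
    (hbot : ∃ x, f x ≠ ⊥) :
    ∃ A B : ℝ, 0 ≤ A ∧ 0 ≤ B ∧ ∀ x, f x ≤ ((A + B * ‖x‖ : ℝ) : EReal) := by
  obtain ⟨x₀, hx₀⟩ := hbot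
  have hH₀ : ∀ x, f x ≠ ⊥ → (x, (f x).toReal) ∈ hypograph Set.univ f := fun x hx =>
    ⟨trivial, (EReal.coe_toReal (htop x) hx).le⟩
  -- A point strictly above the graph is separated from the hypograph. Comparison with the graph
  -- point below it shows that the vertical coefficient `c` is nonzero, so the hyperplane is the
  -- graph of an affine majorant.
  have hnot : (x₀, (f x₀).toReal + 1) ∉ hypograph Set.univ f := by
    rintro ⟨-, h⟩
    rw [← EReal.coe_toReal (htop x₀) hx₀] at h
    have : (f x₀).toReal + 1 ≤ (f x₀).toReal := by exact_mod_cast h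
    linarith
  obtain ⟨g, u, hgu, hg⟩ := geometric_hahn_banach_point_closed
    (convex_hypograph convex_univ hconv) (isClosed_hypograph isClosed_univ hlsc) hnot
  set c : ℝ := g (0, 1) with hc
  set φ : StrongDual ℝ E := g.comp (ContinuousLinearMap.inl ℝ E ℝ) with hφ
  have hsplit : ∀ x t, g (x, t) = φ x + t * c := by
    intro x t
    have : ((x, t) : E × ℝ) = (x, 0) + t • (0, 1) := by simp
    rw [this, map_add, map_smul]
    simp [hφ, hc]
  have hcneg : c < 0 := by
    have h := hgu.trans (hg _ (hH₀ x₀ hx₀))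
    rw [hsplit, hsplit] at h
    linarith
  refine ⟨|u| / (-c), ‖φ‖ / (-c), div_nonneg (abs_nonneg _) (by linarith),
    div_nonneg (norm_nonneg _) (by linarith), fun x => ?_⟩
  rcases eq_or_ne (f x) ⊥ with hx | hx
  · simp [hx]
  · have h := hg _ (hH₀ x hx)
    rw [hsplit] at h
    rw [← EReal.coe_toReal (htop x) hx, EReal.coe_le_coe_iff]
    have h1 : φ x ≤ ‖φ‖ * ‖x‖ := (le_abs_self _).trans (φ.le_opNorm x)
    have h2 : -u ≤ |u| := neg_le_abs u
    rw [div_mul_eq_mul_div, ← add_div, le_div_iff₀ (by linarith)]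
    linarith

theorem exists_maxLoss_le_add_mul_norm {K : ℕ} {Ξ : Set E} {ℓ : Fin K → E → EReal}
    (hℓ : ConvexityAssumption Ξ ℓ) :
    ∃ A B : ℝ, 0 ≤ A ∧ 0 ≤ B ∧ ∀ x, maxLoss ℓ x ≤ ((A + B * ‖x‖ : ℝ) : EReal) := by
  have h : ∀ k, ∃ A B : ℝ, 0 ≤ A ∧ 0 ≤ B ∧ ∀ x, ℓ k x ≤ ((A + B * ‖x‖ : ℝ) : EReal) := by
    intro k
    obtain ⟨x, -, hx⟩ := hℓ.not_bot k
    exact exists_le_add_mul_norm (fun x => (hℓ.lt_top k x).ne) (hℓ.convexFun k) (hℓ.lsc k) ⟨x, hx⟩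
  choose A B hA hB h using h
  refine ⟨∑ k, A k, ∑ k, B k, Finset.sum_nonneg fun k _ => hA k,
    Finset.sum_nonneg fun k _ => hB k, fun x => iSup_le fun k => (h k x).trans ?_⟩
  rw [EReal.coe_le_coe_iff]
  gcongr
  · exact Finset.single_le_sum (fun k _ => hA k) (Finset.mem_univ k)
  · exact Finset.single_le_sum (fun k _ => hB k) (Finset.mem_univ k)

variable [MeasurableSpace E] [BorelSpace E]

theorem ConvexityAssumption.measurable {K : ℕ} {Ξ : Set E} {ℓ : Fin K → E → EReal}
    (hℓ : ConvexityAssumption Ξ ℓ) (k : Fin K) : Measurable (ℓ k) := by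
  have h : Measurable fun x => - -ℓ k x := (hℓ.lsc k).measurable.neg
  simpa using h

theorem measurable_maxLoss {K : ℕ} {Ξ : Set E} {ℓ : Fin K → E → EReal}
    (hℓ : ConvexityAssumption Ξ ℓ) : Measurable (maxLoss ℓ) :=
  Measurable.iSup fun k => hℓ.measurable k

theorem lintegral_maxLoss_ne_top {K : ℕ} {Ξ : Set E} {ℓ : Fin K → E → EReal}
    (hℓ : ConvexityAssumption Ξ ℓ) {Q : Measure E} (hQ : Q ∈ distributions Ξ) :
    ∫⁻ x, (maxLoss ℓ x).toENNReal ∂Q ≠ ⊤ := by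
  obtain ⟨A, B, hA, hB, h⟩ := exists_maxLoss_le_add_mul_norm hℓ
  obtain ⟨hP, -, hm⟩ := hQ
  have hle : ∀ x, (maxLoss ℓ x).toENNReal ≤ ENNReal.ofReal A + ENNReal.ofReal B * ‖x‖ₑ := by
    intro x
    refine (EReal.toENNReal_le_toENNReal (h x)).trans_eq ?_
    rw [EReal.toENNReal_of_ne_top (EReal.coe_ne_top _), EReal.toReal_coe,
      ENNReal.ofReal_add hA (by positivity), ENNReal.ofReal_mul hB, ofReal_norm]
  refine ((lintegral_mono hle).trans_lt ?_).ne
  rw [lintegral_add_left measurable_const, lintegral_const_mul _ measurable_enorm]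
  simpa using ENNReal.mul_lt_top ENNReal.ofReal_lt_top hm

end Majorant

/-! ### Integrals over vanishing mass under a common dominating measure. -/

section UniformIntegrability

/-- Truncation at level `R`: `g ≤ R + (g - R)` with truncated subtraction. The excess is small
uniformly in `n` by domination, and `R * ν n univ` tends to `0`. -/
theorem tendsto_lintegral_zero_of_le_smul {X : Type*} [MeasurableSpace X] {Q : Measure X}
    {C : ℝ≥0∞} (hC : C ≠ ⊤) {ν : ℕ → Measure X} (hν : ∀ n, ν n ≤ C • Q)
    (h0 : Tendsto (fun n => ν n Set.univ) atTop (𝓝 0)) {g : X → ℝ≥0∞} (hg : AEMeasurable g Q)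
    (hfin : ∫⁻ x, g x ∂Q ≠ ⊤) : Tendsto (fun n => ∫⁻ x, g x ∂ν n) atTop (𝓝 0) := by
  have htail : Tendsto (fun R : ℕ => C * ∫⁻ x, (g x - R) ∂Q) atTop (𝓝 0) := by
    have h := tendsto_lintegral_of_dominated_convergence' (μ := Q) (F := fun (R : ℕ) x => g x - R)
      (f := fun _ => 0) g (fun R => hg.sub aemeasurable_const)
      (fun R => ae_of_all _ fun x => tsub_le_self) hfin (by
        filter_upwards [ae_lt_top' hg hfin] with x hx
        obtain ⟨n, hn⟩ := ENNReal.exists_nat_gt hx.ne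
        refine tendsto_const_nhds.congr' ?_
        filter_upwards [eventually_ge_atTop n] with R hR
        exact (tsub_eq_zero_of_le (hn.le.trans (by exact_mod_cast hR))).symm)
    simpa using ENNReal.Tendsto.const_mul h (Or.inr hC)
  rw [ENNReal.tendsto_nhds_zero]
  intro δ hδ
  have hδ2 : 0 < δ / 2 := ENNReal.half_pos hδ.ne'
  obtain ⟨R, hR⟩ := ((ENNReal.tendsto_nhds_zero.1 htail) _ hδ2).exists
  have hR0 : Tendsto (fun n => (R : ℝ≥0∞) * ν n Set.univ) atTop (𝓝 0) := by
    simpa using ENNReal.Tendsto.const_mul h0 (Or.inr (ENNReal.natCast_ne_top R))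
  filter_upwards [(ENNReal.tendsto_nhds_zero.1 hR0) _ hδ2] with n hn
  calc ∫⁻ x, g x ∂ν n ≤ ∫⁻ x, ((R : ℝ≥0∞) + (g x - R)) ∂ν n :=
        lintegral_mono fun x => le_add_tsub
    _ = R * ν n Set.univ + ∫⁻ x, (g x - R) ∂ν n := by
        rw [lintegral_add_left measurable_const, lintegral_const]
    _ ≤ R * ν n Set.univ + C * ∫⁻ x, (g x - R) ∂Q := by
        gcongr
        rw [← smul_eq_mul, ← lintegral_smul_measure]
        exact lintegral_mono' (hν n) le_rfl
    _ ≤ δ / 2 + δ / 2 := add_le_add hn hR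
    _ = δ := ENNReal.add_halves δ

theorem tendsto_integral_zero_of_le_smul {X W : Type*} [MeasurableSpace X] [NormedAddCommGroup W]
    [NormedSpace ℝ W] {Q : Measure X}
    {C : ℝ≥0∞} (hC : C ≠ ⊤) {ν : ℕ → Measure X} (hν : ∀ n, ν n ≤ C • Q)
    (h0 : Tendsto (fun n => ν n Set.univ) atTop (𝓝 0)) {F : X → W} (hF : Integrable F Q) :
    Tendsto (fun n => ∫ x, F x ∂ν n) atTop (𝓝 0) := by
  have h := tendsto_lintegral_zero_of_le_smul hC hν h0 hF.1.enorm hF.2.ne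
  rw [tendsto_zero_iff_enorm_tendsto_zero]
  exact tendsto_of_tendsto_of_tendsto_of_le_of_le tendsto_const_nhds h (fun _ => zero_le)
    fun n => enorm_integral_le_lintegral_enorm F

end UniformIntegrability

/-! ### Splitting a coupling by sample point. -/

section Coupling

/-- The part `1{x = ξhat i} / #{j | ξhat j = ξhat i}` of the mass at `x` attributed to the `i`-th
sample point. -/
noncomputable def sampleWeight {E : Type*} {N : ℕ} (ξhat : Fin N → E) (i : Fin N) (x : E) : ℝ≥0∞ :=
  open Classical in if x = ξhat i then ((Finset.univ.filter fun j => ξhat j = x).card : ℝ≥0∞)⁻¹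
    else 0

theorem sum_sampleWeight {E : Type*} {N : ℕ} (ξhat : Fin N → E) (j : Fin N) :
    ∑ i, sampleWeight ξhat i (ξhat j) = 1 := by
  classical
  have hne : (Finset.univ.filter fun i => ξhat i = ξhat j).Nonempty := ⟨j, by simp⟩
  have hc : ((Finset.univ.filter fun i => ξhat i = ξhat j).card : ℝ≥0∞) ≠ 0 := by
    exact_mod_cast hne.card_pos.ne'
  simp only [sampleWeight]
  rw [← Finset.sum_filter, Finset.sum_const, nsmul_eq_mul]
  simp only [eq_comm (a := ξhat j)]
  convert ENNReal.mul_inv_cancel hc (ENNReal.natCast_ne_top _)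

/-- The matrix of weights is symmetric, so its other marginal sums are `1` too; this gives each
piece of the decomposition total mass `1`. -/
theorem sum_sampleWeight_apply {E : Type*} {N : ℕ} (ξhat : Fin N → E) (i : Fin N) :
    ∑ j, sampleWeight ξhat i (ξhat j) = 1 := by
  classical
  rw [← sum_sampleWeight ξhat i]
  refine Finset.sum_congr rfl fun j _ => ?_
  simp only [sampleWeight]
  by_cases h : ξhat j = ξhat i
  · simp [h]
  · rw [if_neg h, if_neg (Ne.symm h)]

theorem measurable_sampleWeight {E : Type*} [MeasurableSpace E] [MeasurableSingletonClass E] {N : ℕ} (ξhat : Fin N → E)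
    (i : Fin N) : Measurable (sampleWeight ξhat i) := by
  classical
  have : sampleWeight ξhat i = fun x => if x ∈ ({ξhat i} : Set E) then
      ((Finset.univ.filter fun j => ξhat j = ξhat i).card : ℝ≥0∞)⁻¹ else 0 := by
    funext x
    by_cases h : x = ξhat i
    · subst h; simp [sampleWeight]
    · simp [sampleWeight, h]
  rw [this]
  exact Measurable.ite (measurableSet_singleton _) measurable_const measurable_const

/-- A coupling of the empirical distribution with `Q` decomposes `Q` into an average of
distributions, the `i`-th of which describes the transport of the `i`-th sample point. -/
theorem exists_decomposition_of_coupling {E : Type*} [NormedAddCommGroup E] [MeasurableSpace E]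
    [BorelSpace E] [SecondCountableTopology E] {N : ℕ} (hN : 0 < N) {ξhat : Fin N → E}
    {Q : Measure E} {P : Measure (E × E)} (h₁ : P.map Prod.fst = empirical ξhat) (h₂ : P.map Prod.snd = Q) :
    ∃ μ : Fin N → Measure E, (∀ i, IsProbabilityMeasure (μ i)) ∧
      (∑ i, μ i = (N : ℝ≥0∞) • Q) ∧
      ∑ i, ∫⁻ x, ‖ξhat i - x‖ₑ ∂μ i = N * ∫⁻ p, ‖p.1 - p.2‖ₑ ∂P := by
  have hN0 : (N : ℝ≥0∞) ≠ 0 := by exact_mod_cast hN.ne'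
  have hwm := measurable_sampleWeight ξhat
  have hwm' : ∀ i, Measurable fun p : E × E => sampleWeight ξhat i p.1 :=
    fun i => (hwm i).comp measurable_fst
  have hae : ∀ᵐ p ∂P, ∑ i, sampleWeight ξhat i p.1 = 1 := by
    have hms : MeasurableSet (Set.range ξhat)ᶜ := (Set.finite_range ξhat).measurableSet.compl
    have h0 : P (Prod.fst ⁻¹' (Set.range ξhat)ᶜ) = 0 := by
      rw [← Measure.map_apply measurable_fst hms, h₁, empirical]
      simp [Measure.dirac_apply' _ hms]
    have h0' : ∀ᵐ p ∂P, p ∉ Prod.fst ⁻¹' (Set.range ξhat)ᶜ := measure_eq_zero_iff_ae_notMem.1 h0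
    filter_upwards [h0'] with p hp
    simp only [Set.mem_preimage, Set.mem_compl_iff, not_not] at hp
    obtain ⟨j, hj⟩ := hp
    rw [← hj, sum_sampleWeight]
  -- Reweighting by the share of index `i` replaces conditioning on the first coordinate and treats
  -- repeated sample points correctly.
  set μ : Fin N → Measure E := fun i =>
    (N : ℝ≥0∞) • (P.withDensity fun p => sampleWeight ξhat i p.1).map Prod.snd with hμ
  have hint : ∀ i (g : E → ℝ≥0∞), Measurable g →
      ∫⁻ x, g x ∂μ i = N * ∫⁻ p, sampleWeight ξhat i p.1 * g p.2 ∂P := by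
    intro i g hg
    rw [hμ, lintegral_smul_measure, lintegral_map hg measurable_snd,
      lintegral_withDensity_eq_lintegral_mul _ (hwm' i) (g := fun p : E × E => g p.2)
        (hg.comp measurable_snd)]
    rfl
  refine ⟨μ, fun i => ⟨?_⟩, ?_, ?_⟩
  · rw [← lintegral_one, hint i _ measurable_const]
    simp only [mul_one]
    rw [← lintegral_map (hwm i) measurable_fst, h₁, empirical, lintegral_smul_measure,
      lintegral_finsetSum_measure]
    simp only [lintegral_dirac, sum_sampleWeight_apply, smul_eq_mul, mul_one]
    exact ENNReal.mul_inv_cancel hN0 (ENNReal.natCast_ne_top _)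
  · ext s hs
    rw [Measure.finsetSum_apply, Measure.smul_apply, ← h₂, smul_eq_mul]
    have hind : Measurable (s.indicator (1 : E → ℝ≥0∞)) := measurable_one.indicator hs
    simp only [← lintegral_indicator_one hs, hint _ _ hind]
    rw [← Finset.mul_sum, lintegral_map hind measurable_snd,
      ← lintegral_finsetSum (f := fun i (p : E × E) => sampleWeight ξhat i p.1 * s.indicator 1 p.2) _
        fun i _ => (hwm' i).mul (hind.comp measurable_snd)]
    congr 1
    refine lintegral_congr_ae ?_
    filter_upwards [hae] with p hp
    rw [← Finset.sum_mul, hp, one_mul]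
  · have hn : ∀ i, Measurable fun x : E => ‖ξhat i - x‖ₑ := fun i => by fun_prop
    simp only [hint _ _ (hn _)]
    rw [← Finset.mul_sum,
      ← lintegral_finsetSum (f := fun i (p : E × E) => sampleWeight ξhat i p.1 * ‖ξhat i - p.2‖ₑ) _
        fun i _ => (hwm' i).mul ((hn i).comp measurable_snd)]
    congr 1
    refine lintegral_congr_ae ?_
    filter_upwards [hae] with p hp
    -- The weight vanishes unless `p.1 = ξhat i`.
    have : ∀ i, sampleWeight ξhat i p.1 * ‖ξhat i - p.2‖ₑ =
        sampleWeight ξhat i p.1 * ‖p.1 - p.2‖ₑ := by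
      intro i
      by_cases h : p.1 = ξhat i
      · rw [h]
      · simp [sampleWeight, h]
    simp only [this]
    rw [← Finset.sum_mul, hp, one_mul]

end Coupling

/-! ### Extended expectations as Bochner integrals. -/

section Expectation

variable {X : Type*} [MeasurableSpace X] {Q : Measure X} {f : X → EReal}

theorem ae_ne_bot_of_lintegral_neg_ne_top (hf : Measurable f)
    (hneg : ∫⁻ x, (-f x).toENNReal ∂Q ≠ ⊤) : ∀ᵐ x ∂Q, f x ≠ ⊥ := by
  filter_upwards [ae_lt_top (hf.neg.ereal_toENNReal) hneg] with x hx h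
  simp [h] at hx

theorem integrable_toReal_of_lintegral_ne_top (hf : Measurable f) (htop : ∀ x, f x ≠ ⊤)
    (hpos : ∫⁻ x, (f x).toENNReal ∂Q ≠ ⊤) (hneg : ∫⁻ x, (-f x).toENNReal ∂Q ≠ ⊤) :
    Integrable (fun x => (f x).toReal) Q := by
  refine ⟨hf.ereal_toReal.aestronglyMeasurable, ?_⟩
  have hle : ∀ x, ‖(f x).toReal‖ₑ ≤ (f x).toENNReal + (-f x).toENNReal := by
    intro x
    rcases eq_or_ne (f x) ⊥ with h | h
    · simp [h]
    · rw [EReal.toENNReal_of_ne_top (htop x), EReal.toENNReal_of_ne_top (by simpa using h),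
        EReal.toReal_neg_eq, Real.enorm_eq_ofReal_abs]
      rcases abs_cases (f x).toReal with ⟨h, -⟩ | ⟨h, -⟩ <;> rw [h]
      · exact le_self_add
      · exact le_add_self
  refine (lintegral_mono hle).trans_lt ?_
  rw [lintegral_add_left hf.ereal_toENNReal]
  exact ENNReal.add_lt_top.2 ⟨hpos.lt_top, hneg.lt_top⟩

theorem expect_eq_integral_toReal (hf : Measurable f) (htop : ∀ x, f x ≠ ⊤)
    (hpos : ∫⁻ x, (f x).toENNReal ∂Q ≠ ⊤) (hneg : ∫⁻ x, (-f x).toENNReal ∂Q ≠ ⊤) :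
    expect Q f = ((∫ x, (f x).toReal ∂Q : ℝ) : EReal) := by
  rw [expect, if_neg hpos, integral_eq_lintegral_pos_part_sub_lintegral_neg_part
    (integrable_toReal_of_lintegral_ne_top hf htop hpos hneg)]
  have h1 : ∫⁻ x, ENNReal.ofReal (f x).toReal ∂Q = ∫⁻ x, (f x).toENNReal ∂Q :=
    lintegral_congr fun x => (EReal.toENNReal_of_ne_top (htop x)).symm
  have h2 : ∫⁻ x, ENNReal.ofReal (-(f x).toReal) ∂Q = ∫⁻ x, (-f x).toENNReal ∂Q := by
    refine lintegral_congr_ae ?_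
    filter_upwards [ae_ne_bot_of_lintegral_neg_ne_top hf hneg] with x hx
    rw [EReal.toENNReal_of_ne_top (by simpa using hx), EReal.toReal_neg_eq]
  rw [h1, h2, EReal.coe_sub]
  simp only [← EReal.toReal_coe_ennreal]
  rw [EReal.coe_toReal (by simpa using hpos) (EReal.coe_ennreal_ne_bot _),
    EReal.coe_toReal (by simpa using hneg) (EReal.coe_ennreal_ne_bot _)]

end Expectation

/-! ### Jensen's inequality and limits in perspective cones. -/

section Perspective

variable {W : Type*} [NormedAddCommGroup W] [NormedSpace ℝ W] {C : Set W}

/-- Jensen in geometric form: the integral is the mass times an average, and averages stay in a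
closed convex set. A null set gives the apex. -/
theorem mem_perspective_of_setIntegral [CompleteSpace W] {X : Type*} [MeasurableSpace X]
    {μ : Measure X} [IsFiniteMeasure μ] (hC : Convex ℝ C) (hcl : IsClosed C) (hne : C.Nonempty)
    {A : Set X} {G : X → W} (hG : IntegrableOn G A μ) (hA : ∀ᵐ x ∂μ.restrict A, G x ∈ C) :
    (μ.real A, ∫ x in A, G x ∂μ) ∈ perspective C := by
  refine ⟨measureReal_nonneg, ?_⟩
  rcases eq_or_ne (μ A) 0 with h0 | h0
  · obtain ⟨y, hy⟩ := hne
    exact ⟨y, hy, by simp [Measure.restrict_eq_zero.2 h0, measureReal_def, h0]⟩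
  · refine ⟨⨍ x in A, G x ∂μ, hC.set_average_mem hcl h0 (measure_ne_top _ _) hA hG, ?_⟩
    have : μ.real A ≠ 0 := (ENNReal.toReal_pos h0 (measure_ne_top _ _)).ne'
    rw [setAverage_eq, smul_inv_smul₀ this]

/-- For unbounded `C`, limits with mass `0` may be nonzero recession directions, outside the cone;
`hq` rules these out. At positive mass one divides by it. -/
theorem mem_perspective_of_tendsto (hcl : IsClosed C) {p : ℕ → ℝ × W} {q : ℝ × W}
    (hp : ∀ n, p n ∈ perspective C) (hpq : Tendsto p atTop (𝓝 q)) (hq : q.1 = 0 → q.2 = 0) :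
    q ∈ perspective C := by
  have h1 : Tendsto (fun n => (p n).1) atTop (𝓝 q.1) := (continuous_fst.tendsto q).comp hpq
  have h2 : Tendsto (fun n => (p n).2) atTop (𝓝 q.2) := (continuous_snd.tendsto q).comp hpq
  refine ⟨ge_of_tendsto' h1 fun n => (hp n).1, ?_⟩
  rcases eq_or_ne q.1 0 with h0 | h0
  · obtain ⟨x, hx, -⟩ := (hp 0).2
    exact ⟨x, hx, by rw [h0, hq h0, zero_smul]⟩
  · refine ⟨q.1⁻¹ • q.2, hcl.mem_of_tendsto ((h1.inv₀ h0).smul h2) ?_, (smul_inv_smul₀ h0 _).symm⟩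
    filter_upwards [h1.eventually_ne h0] with n hn
    obtain ⟨x, hx, h⟩ := (hp n).2
    rwa [h, inv_smul_smul₀ hn]

end Perspective

/-! ### From distributions in the ball to feasible points. -/

section UpperBound

theorem exists_coupling_lt {E : Type*} [NormedAddCommGroup E] [MeasurableSpace E]
    {Q₁ Q₂ : Measure E} {c : ℝ≥0∞} (h : wasserstein Q₁ Q₂ < c) :
    ∃ P : Measure (E × E), P.map Prod.fst = Q₁ ∧ P.map Prod.snd = Q₂ ∧
      ∫⁻ p, ‖p.1 - p.2‖ₑ ∂P < c := by
  simp only [wasserstein, iInf_lt_iff] at h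
  obtain ⟨P, ⟨h1, h2⟩, h3⟩ := h
  exact ⟨P, h1, h2, h3⟩

/-- Each vector is the integral of `ξhat i - x` over `A k`, so its norm is at most the transport
cost incurred on `A k`; disjointness lets these costs add up. -/
theorem sum_norm_le_of_decomposition {E : Type*} [NormedAddCommGroup E] [NormedSpace ℝ E]
    [MeasurableSpace E] [CompleteSpace E] {N K : ℕ} {ξhat : Fin N → E}
    {μ : Fin N → Measure E} (hμ : ∀ i, IsProbabilityMeasure (μ i))
    (hint : ∀ i, Integrable (fun x => x) (μ i)) {A : Fin K → Set E}
    (hAm : ∀ k, MeasurableSet (A k)) (hAd : Pairwise (Function.onFun Disjoint A)) {c : ℝ}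
    (hc : 0 ≤ c) (h : ∑ i, ∫⁻ x, ‖ξhat i - x‖ₑ ∂μ i ≤ ENNReal.ofReal c) :
    ∑ i, ∑ k, ‖(μ i).real (A k) • ξhat i - ∫ x in A k, x ∂μ i‖ ≤ c := by
  rw [← ENNReal.ofReal_le_ofReal_iff hc]
  refine le_trans ?_ h
  rw [ENNReal.ofReal_sum_of_nonneg fun i _ => by positivity]
  refine Finset.sum_le_sum fun i _ => ?_
  rw [ENNReal.ofReal_sum_of_nonneg fun k _ => norm_nonneg _]
  calc ∑ k, ENNReal.ofReal ‖(μ i).real (A k) • ξhat i - ∫ x in A k, x ∂μ i‖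
      ≤ ∑ k, ∫⁻ x in A k, ‖ξhat i - x‖ₑ ∂μ i := by
        refine Finset.sum_le_sum fun k _ => ?_
        rw [← setIntegral_const, ← integral_sub (integrable_const _) (hint i).integrableOn,
          ofReal_norm]
        exact enorm_integral_le_lintegral_enorm _
    _ = ∫⁻ x in ⋃ k, A k, ‖ξhat i - x‖ₑ ∂μ i := by
        rw [lintegral_iUnion hAm hAd, tsum_fintype]
    _ ≤ ∫⁻ x, ‖ξhat i - x‖ₑ ∂μ i := setLIntegral_le_lintegral _ _

variable {E : Type*} [NormedAddCommGroup E] [NormedSpace ℝ E]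
  [MeasurableSpace E] [BorelSpace E]

/-- The space can be partitioned according to an index at which the maximum is attained. -/
theorem exists_argmax_partition {K : ℕ} (hK : 0 < K) {Ξ : Set E} {ℓ : Fin K → E → EReal}
    (hℓ : ConvexityAssumption Ξ ℓ) :
    ∃ A : Fin K → Set E, (∀ k, MeasurableSet (A k)) ∧ Pairwise (Function.onFun Disjoint A) ∧
      ⋃ k, A k = Set.univ ∧ ∀ k, ∀ x ∈ A k, ℓ k x = maxLoss ℓ x := by
  have hm : ∀ k, MeasurableSet {x | ℓ k x = maxLoss ℓ x} := fun k =>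
    measurableSet_eq_fun (hℓ.measurable k) (measurable_maxLoss hℓ)
  -- Ties are resolved in favour of the smallest index.
  refine ⟨disjointed fun k => {x | ℓ k x = maxLoss ℓ x}, fun k => ?_, disjoint_disjointed _, ?_,
    fun k x hx => disjointed_subset _ k hx⟩
  · exact disjointedRec (p := MeasurableSet) (fun _ j ht => ht.diff (hm j)) (hm k)
  · rw [iUnion_disjointed]
    refine Set.eq_univ_of_forall fun x => ?_
    have : Nonempty (Fin K) := ⟨⟨0, hK⟩⟩
    obtain ⟨k, hk⟩ := exists_eq_ciSup_of_finite (f := fun k => ℓ k x)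
    exact Set.mem_iUnion.2 ⟨k, hk⟩

/-- Every distribution in the Wasserstein ball for which the maximal loss is integrable is dominated
by a feasible point of the finite program. -/
theorem exists_feasible_of_mem_wassersteinBall [FiniteDimensional ℝ E] {N K : ℕ} (hN : 0 < N)
    (hK : 0 < K) {Ξ : Set E} {ξhat : Fin N → E} (hξ : ∀ i, ξhat i ∈ Ξ) {ℓ : Fin K → E → EReal}
    (hℓ : ConvexityAssumption Ξ ℓ) {ε : ℝ} (hε : 0 ≤ ε) {Q : Measure E}
    (hQ : Q ∈ wassersteinBall Ξ (empirical ξhat) ε)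
    (hneg : ∫⁻ x, (-maxLoss ℓ x).toENNReal ∂Q ≠ ⊤) :
    ∃ d ∈ feasibleSet K Ξ ξhat ε,
      ((∫ x, (maxLoss ℓ x).toReal ∂Q : ℝ) : EReal) ≤ objective ξhat ℓ d := by
  obtain ⟨hQd, hW⟩ := hQ
  have hpos := lintegral_maxLoss_ne_top hℓ hQd
  have hLm := measurable_maxLoss hℓ
  have hLint := integrable_toReal_of_lintegral_ne_top hLm (maxLoss_ne_top hℓ) hpos hneg
  have hbot := ae_ne_bot_of_lintegral_neg_ne_top hLm hneg
  obtain ⟨hQp, hQΞ, hQm⟩ := hQd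
  have hQΞ' : ∀ᵐ x ∂Q, x ∈ Ξ := hQΞ
  have hxint : Integrable (fun x : E => x) Q := ⟨measurable_id.aestronglyMeasurable, hQm⟩
  set G : E → E × ℝ := fun x => (x, (maxLoss ℓ x).toReal) with hGdef
  have hG : Integrable G Q := hxint.prodMk hLint
  have hNtop : (N : ℝ≥0∞) ≠ ⊤ := ENNReal.natCast_ne_top N
  have hNpos : (0 : ℝ) < N := by exact_mod_cast hN
  obtain ⟨A, hAm, hAd, hAU, hAmax⟩ := exists_argmax_partition hK hℓ
  have hδ : ∀ n : ℕ, (0 : ℝ) < 1 / ((n : ℝ) + 1) := fun n => by positivity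
  have hP : ∀ n : ℕ, ∃ μ : Fin N → Measure E, (∀ i, IsProbabilityMeasure (μ i)) ∧
      (∑ i, μ i = (N : ℝ≥0∞) • Q) ∧
      ∑ i, ∫⁻ x, ‖ξhat i - x‖ₑ ∂μ i ≤ ENNReal.ofReal (N * (ε + 1 / ((n : ℝ) + 1))) := by
    intro n
    have hlt : wasserstein (empirical ξhat) Q < ENNReal.ofReal (ε + 1 / ((n : ℝ) + 1)) :=
      hW.trans_lt ((ENNReal.ofReal_lt_ofReal_iff (add_pos_of_nonneg_of_pos hε (hδ n))).2
        (lt_add_of_pos_right _ (hδ n)))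
    obtain ⟨P, h1, h2, h3⟩ := exists_coupling_lt hlt
    obtain ⟨μ, hμ1, hμ2, hμ3⟩ := exists_decomposition_of_coupling hN h1 h2
    refine ⟨μ, hμ1, hμ2, ?_⟩
    rw [hμ3, ENNReal.ofReal_mul (by positivity), ENNReal.ofReal_natCast]
    gcongr
  choose μ hμp hμs hμc using hP
  -- This domination, uniform in `n`, yields both boundedness of the moments and their uniform
  -- integrability.
  have hμle : ∀ n i, μ n i ≤ (N : ℝ≥0∞) • Q := fun n i => by
    rw [← hμs n]
    exact Finset.single_le_sum (f := fun i => μ n i) (fun _ _ => Measure.zero_le _)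
      (Finset.mem_univ i)
  have hGμ : ∀ n i, Integrable G (μ n i) := fun n i => hG.of_measure_le_smul hNtop (hμle n i)
  have hxμ : ∀ n i, Integrable (fun x : E => x) (μ n i) := fun n i => (hGμ n i).fst
  have hac : ∀ n i, μ n i ≪ Q := fun n i => Measure.absolutelyContinuous_of_le_smul (hμle n i)
  -- Mass, first moment and loss carried from `ξhat i` into `A k`.
  set Z : ℕ → Fin N → Fin K → ℝ × (E × ℝ) := fun n i k =>
    ((μ n i).real (A k), ∫ x in A k, G x ∂μ n i) with hZ
  have hZ21 : ∀ n i k, (Z n i k).2.1 = ∫ x in A k, x ∂μ n i := fun n i k =>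
    fst_integral (hGμ n i).integrableOn
  have hZ22 : ∀ n i k, (Z n i k).2.2 = ∫ x in A k, (maxLoss ℓ x).toReal ∂μ n i := fun n i k =>
    snd_integral (hGμ n i).integrableOn
  have hZmem : ∀ n i k, Z n i k ∈ perspective (hypograph Ξ (ℓ k)) := by
    intro n i k
    refine mem_perspective_of_setIntegral (convex_hypograph hℓ.convex (hℓ.convexFun k))
      (isClosed_hypograph hℓ.isClosed (hℓ.lsc k)) (hℓ.hypograph_nonempty k)
      (hGμ n i).integrableOn ?_
    rw [ae_restrict_iff' (hAm k)]
    filter_upwards [(hac n i).ae_le hbot, (hac n i).ae_le hQΞ'] with x hx hxΞ hxA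
    refine ⟨hxΞ, ?_⟩
    simp only [hGdef]
    rw [hAmax k x hxA, EReal.coe_toReal (maxLoss_ne_top hℓ x) hx]
  have hZsum : ∀ n i, ∑ k, (Z n i k).1 = 1 := by
    intro n i
    have h := integral_iUnion_fintype (μ := μ n i) (f := fun _ => (1 : ℝ)) hAm hAd
      fun k => integrableOn_const
    rw [hAU] at h
    simpa using h.symm
  -- The total loss does not depend on `n`, because the `μ n i` always add up to `N • Q`; it
  -- therefore survives in the limit.
  have hZobj : ∀ n, ∑ i, ∑ k, (Z n i k).2.2 = N * ∫ x, (maxLoss ℓ x).toReal ∂Q := by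
    intro n
    have h1 : ∀ i, ∑ k, (Z n i k).2.2 = ∫ x, (maxLoss ℓ x).toReal ∂μ n i := by
      intro i
      simp only [hZ22]
      rw [← integral_iUnion_fintype hAm hAd fun k => (hGμ n i).snd.integrableOn, hAU,
        setIntegral_univ]
    simp only [h1]
    rw [← integral_finsetSum_measure fun i _ => (hGμ n i).snd, hμs, integral_smul_measure]
    simp [hGdef]
  have hZcost : ∀ n, ∑ i, ∑ k, ‖(Z n i k).1 • ξhat i - (Z n i k).2.1‖ ≤
      N * (ε + 1 / ((n : ℝ) + 1)) := by
    intro n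
    simp only [hZ21]
    exact sum_norm_le_of_decomposition (hμp n) (hxμ n) hAm hAd
      (mul_nonneg hNpos.le (add_nonneg hε (hδ n).le)) (hμc n)
  have hZbdd : ∀ n, Z n ∈ Metric.closedBall (0 : Fin N → Fin K → ℝ × (E × ℝ))
      (max 1 (N * ∫ x, ‖G x‖ ∂Q)) := by
    intro n
    have h0 : 0 ≤ max 1 (N * ∫ x, ‖G x‖ ∂Q) := zero_le_one.trans (le_max_left _ _)
    rw [mem_closedBall_zero_iff, pi_norm_le_iff_of_nonneg h0]
    intro i
    rw [pi_norm_le_iff_of_nonneg h0]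
    intro k
    refine max_le_max ?_ ?_
    · rw [Real.norm_of_nonneg measureReal_nonneg]
      have := hμp n i
      exact measureReal_le_one
    · calc ‖∫ x in A k, G x ∂μ n i‖ ≤ ∫ x in A k, ‖G x‖ ∂μ n i := norm_integral_le_integral_norm _
        _ ≤ ∫ x, ‖G x‖ ∂((N : ℝ≥0∞) • Q) := by
          refine integral_mono_measure (Measure.restrict_le_self.trans (hμle n i))
            (ae_of_all _ fun x => norm_nonneg _) (hG.norm.smul_measure hNtop)
        _ = N * ∫ x, ‖G x‖ ∂Q := by simp [integral_smul_measure]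
  obtain ⟨z, -, φ, hφ, hlim⟩ := tendsto_subseq_of_bounded Metric.isBounded_closedBall hZbdd
  have hlim' : ∀ i k, Tendsto (fun n => Z (φ n) i k) atTop (𝓝 (z i k)) := fun i k =>
    tendsto_pi_nhds.1 (tendsto_pi_nhds.1 hlim i) k
  have hlim1 : ∀ i k, Tendsto (fun n => (Z (φ n) i k).1) atTop (𝓝 (z i k).1) := fun i k =>
    (continuous_fst.tendsto _).comp (hlim' i k)
  have hlim2 : ∀ i k, Tendsto (fun n => (Z (φ n) i k).2) atTop (𝓝 (z i k).2) := fun i k =>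
    (continuous_snd.tendsto _).comp (hlim' i k)
  have hlim21 : ∀ i k, Tendsto (fun n => (Z (φ n) i k).2.1) atTop (𝓝 (z i k).2.1) := fun i k =>
    (continuous_fst.tendsto _).comp (hlim2 i k)
  have hlim22 : ∀ i k, Tendsto (fun n => (Z (φ n) i k).2.2) atTop (𝓝 (z i k).2.2) := fun i k =>
    (continuous_snd.tendsto _).comp (hlim2 i k)
  have hzmem : ∀ i k, z i k ∈ perspective (hypograph Ξ (ℓ k)) := by
    intro i k
    refine mem_perspective_of_tendsto (isClosed_hypograph hℓ.isClosed (hℓ.lsc k))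
      (fun n => hZmem (φ n) i k) (hlim' i k) fun h0 => ?_
    -- If the limiting mass is `0`, the measures restricted to `A k` lose their mass while staying
    -- below `N • Q`, so the moments vanish too.
    refine tendsto_nhds_unique (hlim2 i k) (tendsto_integral_zero_of_le_smul hNtop
      (fun n => Measure.restrict_le_self.trans (hμle (φ n) i)) ?_ hG)
    have h := ENNReal.tendsto_ofReal (hlim1 i k)
    rw [h0, ENNReal.ofReal_zero] at h
    refine h.congr fun n => ?_
    have := hμp (φ n) i
    simp [hZ]
  -- The choice of `q` solves `α ξhat - q =` limiting first moment.
  refine ⟨(fun i k => (z i k).1, fun i k => (z i k).1 • ξhat i - (z i k).2.1), ?_⟩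
  rw [feasible_and_le_objective_iff hN hξ hℓ]
  refine ⟨?_, fun i => ?_, fun i k => (z i k).2.2, ?_, fun i k => ?_⟩
  · have hl : Tendsto (fun n => ∑ i, ∑ k, ‖(Z (φ n) i k).1 • ξhat i - (Z (φ n) i k).2.1‖) atTop
        (𝓝 (∑ i, ∑ k, ‖(z i k).1 • ξhat i - (z i k).2.1‖)) :=
      tendsto_finsetSum _ fun i _ => tendsto_finsetSum _ fun k _ =>
        (((hlim1 i k).smul_const _).sub (hlim21 i k)).norm
    have hr : Tendsto (fun n : ℕ => (N : ℝ) * (ε + 1 / ((φ n : ℝ) + 1))) atTop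
        (𝓝 (N * (ε + 0))) :=
      ((tendsto_one_div_add_atTop_nhds_zero_nat.comp hφ.tendsto_atTop).const_add ε).const_mul _
    have h := le_of_tendsto_of_tendsto' hl hr fun n => hZcost (φ n)
    rw [inv_mul_le_iff₀ hNpos]
    simpa using h
  · refine tendsto_nhds_unique (tendsto_finsetSum _ fun k _ => hlim1 i k) ?_
    simp only [hZsum]
    exact tendsto_const_nhds
  · have hl : Tendsto (fun n => ∑ i, ∑ k, (Z (φ n) i k).2.2) atTop (𝓝 (∑ i, ∑ k, (z i k).2.2)) :=
      tendsto_finsetSum _ fun i _ => tendsto_finsetSum _ fun k _ => hlim22 i k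
    simp only [hZobj] at hl
    rw [← tendsto_nhds_unique tendsto_const_nhds hl, inv_mul_cancel_left₀ hNpos.ne']
  · simpa using hzmem i k

end UpperBound

end WassersteinDRO

/-! ### The two bounds combined. -/

theorem mainTheorem2
    {E : Type*} [NormedAddCommGroup E] [NormedSpace ℝ E] [FiniteDimensional ℝ E]
    [MeasurableSpace E] [BorelSpace E]
    {N K : ℕ} (hN : 0 < N) (hK : 0 < K)
    (Ξ : Set E) (ξhat : Fin N → E) (hξ : ∀ i, ξhat i ∈ Ξ)
    (ℓ : Fin K → E → EReal) (hℓ : WassersteinDRO.ConvexityAssumption Ξ ℓ)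
    (ε : ℝ) (hε : 0 ≤ ε) :
    -- the finite program is convex: concave objective over a convex feasible set
    WassersteinDRO.IsConvexFunOn (WassersteinDRO.feasibleSet K Ξ ξhat ε)
      (fun d => -WassersteinDRO.objective ξhat ℓ d) ∧
    -- its optimal value is the worst-case expectation
    WassersteinDRO.worstCaseExpectation
        (WassersteinDRO.wassersteinBall Ξ (WassersteinDRO.empirical ξhat) ε)
        (WassersteinDRO.maxLoss ℓ) =
      WassersteinDRO.programValue Ξ ξhat ℓ ε ∧
    -- maximizing sequences induce asymptotically worst-case distributions
    ∀ d : ℕ → WassersteinDRO.Decision E N K,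
      (∀ r, d r ∈ WassersteinDRO.feasibleSet K Ξ ξhat ε) →
      Tendsto (fun r => WassersteinDRO.objective ξhat ℓ (d r)) atTop
        (𝓝 (WassersteinDRO.programValue Ξ ξhat ℓ ε)) →
      (∀ r, WassersteinDRO.inducedDistribution ξhat (d r) ∈
        WassersteinDRO.wassersteinBall Ξ (WassersteinDRO.empirical ξhat) ε) ∧
      Tendsto
        (fun r => WassersteinDRO.expect (WassersteinDRO.inducedDistribution ξhat (d r))
          (WassersteinDRO.maxLoss ℓ)) atTop
        (𝓝 (WassersteinDRO.worstCaseExpectation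
          (WassersteinDRO.wassersteinBall Ξ (WassersteinDRO.empirical ξhat) ε)
          (WassersteinDRO.maxLoss ℓ))) ∧
      Tendsto
        (fun r => (((N : ℝ)⁻¹ : ℝ) : EReal) * ∑ i, ∑ k, ((d r).1 i k : EReal) *
          WassersteinDRO.maxLoss ℓ (WassersteinDRO.atom ξhat (d r) i k)) atTop
        (𝓝 (WassersteinDRO.worstCaseExpectation
          (WassersteinDRO.wassersteinBall Ξ (WassersteinDRO.empirical ξhat) ε)
          (WassersteinDRO.maxLoss ℓ))) := by
  have hge : WassersteinDRO.programValue Ξ ξhat ℓ ε ≤ WassersteinDRO.worstCaseExpectation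
      (WassersteinDRO.wassersteinBall Ξ (WassersteinDRO.empirical ξhat) ε)
      (WassersteinDRO.maxLoss ℓ) :=
    iSup₂_le fun d hd =>
      (WassersteinDRO.objective_le_expect_inducedDistribution hN ξhat hd.2.2.1 hℓ).trans <|
        le_iSup₂_of_le (WassersteinDRO.inducedDistribution ξhat d)
          (WassersteinDRO.inducedDistribution_mem_wassersteinBall hN hd) le_rfl
  have hle : WassersteinDRO.worstCaseExpectation
      (WassersteinDRO.wassersteinBall Ξ (WassersteinDRO.empirical ξhat) ε)
      (WassersteinDRO.maxLoss ℓ) ≤ WassersteinDRO.programValue Ξ ξhat ℓ ε := by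
    refine iSup₂_le fun Q hQ => ?_
    have hpos := WassersteinDRO.lintegral_maxLoss_ne_top hℓ hQ.1
    by_cases hneg : ∫⁻ x, (-WassersteinDRO.maxLoss ℓ x).toENNReal ∂Q = ⊤
    · have : WassersteinDRO.expect Q (WassersteinDRO.maxLoss ℓ) = ⊥ := by
        rw [WassersteinDRO.expect, if_neg hpos, hneg, EReal.coe_ennreal_top]
        exact EReal.sub_top _
      rw [this]
      exact bot_le
    · obtain ⟨d, hd, h⟩ :=
        WassersteinDRO.exists_feasible_of_mem_wassersteinBall hN hK hξ hℓ hε hQ hneg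
      rw [WassersteinDRO.expect_eq_integral_toReal (WassersteinDRO.measurable_maxLoss hℓ)
        (WassersteinDRO.maxLoss_ne_top hℓ) hpos hneg]
      exact h.trans (le_iSup₂_of_le d hd le_rfl)
  have heq := le_antisymm hle hge
  refine ⟨WassersteinDRO.isConvexFunOn_neg_objective hN hξ hℓ ε, heq, fun d hd hlim => ?_⟩
  have hball := fun r =>
    WassersteinDRO.inducedDistribution_mem_wassersteinBall (Ξ := Ξ) (ε := ε) hN (hd r)
  rw [← heq] at hlim
  -- The expectations are squeezed between the objective values and the worst-case expectation.
  have hexp := tendsto_of_tendsto_of_tendsto_of_le_of_le hlim tendsto_const_nhds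
    (fun r => WassersteinDRO.objective_le_expect_inducedDistribution hN ξhat (hd r).2.2.1 hℓ)
    (fun r => le_iSup₂_of_le (f := fun Q (_ : Q ∈ WassersteinDRO.wassersteinBall Ξ
      (WassersteinDRO.empirical ξhat) ε) => WassersteinDRO.expect Q (WassersteinDRO.maxLoss ℓ))
      _ (hball r) le_rfl)
  refine ⟨hball, hexp, hexp.congr fun r => ?_⟩
  exact WassersteinDRO.expect_inducedDistribution hN ξhat (hd r).2.2.1
    (WassersteinDRO.maxLoss_ne_top hℓ)
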